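/- Graphs are finite and simple, $d_G(u,v)$ is the usual distance in a connected graph $G$, the order of $G$ is its number of vertices, and its diameter is the largest distance between two of its vertices. All sums below run over the unordered pairs of distinct vertices of $G$. For $\lambda\in\mathbb{R}$ let $$W^{\lambda}(G)=\sum_{\{u,v\}\subseteq V(G)} d_G(u,v)^{\lambda},\quad WW(G)=\sum_{\{u,v\}\subseteq V(G)}\binom{1+d_G(u,v)}{2},\quad H(G)=\sum_{\{u,v\}\subseteq V(G)}\frac{1}{d_G(u,v)},$$ $$RCW(G)=\sum_{\{u,v\}\subseteq V(G)}\frac{1}{\operatorname{diam}(G)+1-d_G(u,v)}$$ be the generalised Wiener index, the hyper-Wiener index, the Harary index and the reciprocal complementary Wiener index of $G$. Let $d,n$ be integers with $1<d\le n-1$, and let $\mathbf{T}_{d,n}$ be the tree of order $n$ and diameter $d$ obtained by attaching $n-d-1$ pendent edges to a centre vertex of the path on $d+1$ vertices. Then, among all trees of order $n$ and diameter $d$, the tree $\mathbf{T}_{d,n}$ is, up to isomorphism, (a) for every real $\lambda>0$, the unique tree that minimises $W^{\lambda}$; (b) for every real $\lambda<0$, the unique tree that maximises $W^{\lambda}$;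 (c) the unique tree that minimises $WW$; (d) the unique tree that maximises $H$; (e) the unique tree that minimises $RCW$. -/

import Mathlib

namespace WienerIndices

noncomputable section

/-- The distance between the two ends of an unordered pair of vertices of `G`. -/
def pairDist {V : Type*} (G : SimpleGraph V) : Sym2 V → ℕ :=
  Sym2.lift ⟨fun u v => G.dist u v, fun _ _ => G.dist_comm⟩

open Classical in
/-- The Wiener-type index `W(G; g)`: the sum of `g (d(u, v))` over all unordered pairs `{u, v}`
of distinct vertices of `G`. -/
def wienerType {V : Type*} [Fintype V] (G : SimpleGraph V) (g : ℕ → ℝ) : ℝ :=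
  ∑ e : Sym2 V with ¬ e.IsDiag, g (pairDist G e)

/-- The generalised Wiener index: the sum of `d(u, v) ^ lam`, for a real exponent `lam`. -/
def generalisedWiener {V : Type*} [Fintype V] (lam : ℝ) (G : SimpleGraph V) : ℝ :=
  wienerType G fun k => (k : ℝ) ^ lam

/-- The hyper-Wiener index: the sum of the binomial coefficients `1 + d(u, v)` choose `2`. -/
def hyperWiener {V : Type*} [Fintype V] (G : SimpleGraph V) : ℝ :=
  wienerType G fun k => ((1 + k).choose 2 : ℝ)

/-- The Harary index: the sum of `1 / d(u, v)`. -/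
def harary {V : Type*} [Fintype V] (G : SimpleGraph V) : ℝ :=
  wienerType G fun k => 1 / (k : ℝ)

/-- The reciprocal complementary Wiener index: the sum of `1 / (d + 1 - d(u, v))`, where `d` is
the diameter of `G`. -/
def reciprocalComplementaryWiener {V : Type*} [Fintype V] (G : SimpleGraph V) : ℝ :=
  wienerType G fun k => 1 / ((G.diam : ℝ) + 1 - (k : ℝ))

/-- The tree obtained from the path `0, 1, …, d` on `d + 1` vertices by attaching the remaining
`n - d - 1` vertices `d + 1, …, n - 1` as pendent vertices to the centre vertex `⌊d / 2⌋` of the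
path. -/
def diamTree (d n : ℕ) : SimpleGraph (Fin n) :=
  SimpleGraph.fromRel fun u v : Fin n =>
    ((u : ℕ) + 1 = v ∧ (v : ℕ) ≤ d) ∨ ((u : ℕ) = d / 2 ∧ d < (v : ℕ))

end

end WienerIndices

/-! Each index sums a weight `g` of the distances which, up to sign, increases strictly on `1, …,
d`. Every tree of order `n` has `n - 1` pairs at distance 1, so raising `g 1` to `g 2` shifts all
competing sums equally (`pairSum_add_ite_of_isTree`). The new weight `f` satisfies `f 1 = f 2` and
increases strictly from 2 on.

Fix a diametral path. A vertex off it, at distance `h ≥ 1` with nearest point `j`, is at distance `h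
+ |i - j|` from the `i`-th path vertex (`IsTree.exists_dist_geodesic`), so its sum against the path
is least for `h = 1` and `j` central (`eq_of_pathSum_eq`). Two distinct vertices off the path
contribute at least `f 2`. All bounds are attained when every vertex off the path hangs from one
centre. Conversely, equality hangs each of them from a centre and keeps them within distance 2 of
each other; vertices on distinct centres would be at distance 3, so the centre is common and the
tree is determined. -/

namespace SimpleGraph

/-! ### Geodesics in trees -/

variable {V : Type*} {G : SimpleGraph V}

/-- In a tree, a vertex `v` has at most one neighbour closer to a given vertex `x`. -/
lemma IsTree.eq_of_adj_of_dist_lt (hG : G.IsTree) {x u v w : V} (hu : G.Adj u v) (hw : G.Adj w v)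
    (hxu : G.dist x u < G.dist x v) (hxw : G.dist x w < G.dist x v) : u = w := by
  -- A geodesic to a closer neighbour extends to a path ending at `v`, and paths in a tree are
  -- unique.
  have key : ∀ {u : V} (_ : G.Adj u v), G.dist x u < G.dist x v →
      ∃ p : G.Walk x v, p.IsPath ∧ p.penultimate = u := by
    intro u hu hlt
    obtain ⟨p, hp, hlen⟩ := hG.1.exists_path_of_dist x u
    refine ⟨p.concat hu, hp.concat (fun hv => ?_) hu, by simp⟩
    classical
    have h1 := dist_le (p.takeUntil v hv)
    have h2 := p.length_takeUntil_le_length hv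
    omega
  obtain ⟨p, hp, rfl⟩ := key hu hxu
  obtain ⟨q, hq, rfl⟩ := key hw hxw
  rw [(hG.existsUnique_path x v).unique hp hq]

/-- The vertices `p 0, …, p d` form a geodesic path of length `d`. -/
def IsGeodesic (G : SimpleGraph V) (d : ℕ) (p : ℕ → V) : Prop :=
  ∀ i ≤ d, ∀ j ≤ d, G.dist (p i) (p j) = (i - j) + (j - i)

lemma IsGeodesic.reverse {d : ℕ} {p : ℕ → V} (hp : G.IsGeodesic d p) :
    G.IsGeodesic d fun i => p (d - i) := by
  intro i hi j hj
  rw [hp _ (by omega) _ (by omega)]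
  omega

lemma IsGeodesic.eq_of_eq {d : ℕ} {p : ℕ → V} (hp : G.IsGeodesic d p) {i j : ℕ} (hi : i ≤ d)
    (hj : j ≤ d) (h : p i = p j) : i = j := by
  have := hp i hi j hj
  rw [h, dist_self] at this
  omega

lemma IsGeodesic.adj {d : ℕ} {p : ℕ → V} (hp : G.IsGeodesic d p) {i : ℕ} (hi : i < d) :
    G.Adj (p i) (p (i + 1)) := by
  rw [← dist_eq_one_iff_adj, hp i hi.le (i + 1) hi]
  omega

/-- Along a shortest walk the three pieces cut off by two vertices have lengths adding up to the
distance of the ends, so no piece can be shortened. -/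
lemma Connected.exists_isGeodesic (hG : G.Connected) (u v : V) :
    ∃ p : ℕ → V, G.IsGeodesic (G.dist u v) p := by
  obtain ⟨w, hw⟩ := hG.exists_walk_length_eq_dist u v
  have key : ∀ i j, i ≤ j → j ≤ G.dist u v → G.dist (w.getVert i) (w.getVert j) = j - i := by
    intro i j hij hj
    have h1 : G.dist u (w.getVert i) ≤ i := by
      have := dist_le (w.take i)
      rw [Walk.take_length] at this
      omega
    have h2 : G.dist (w.getVert j) v ≤ G.dist u v - j := by
      have := dist_le (w.drop j)
      rw [Walk.drop_length] at this
      omega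
    have h3 : G.dist (w.getVert i) (w.getVert j) ≤ j - i := by
      have hget : (w.drop i).getVert (j - i) = w.getVert j := by
        rw [Walk.drop_getVert]
        congr 1
        omega
      have := dist_le ((w.drop i).take (j - i))
      rw [Walk.take_length, hget] at this
      omega
    have h4 := hG.dist_triangle (u := u) (v := w.getVert i) (w := v)
    have h5 := hG.dist_triangle (u := w.getVert i) (v := w.getVert j) (w := v)
    omega
  refine ⟨w.getVert, fun i hi j hj => ?_⟩
  rcases le_total i j with h | h
  · rw [key i j h hj]
    omega
  · rw [dist_comm, key j i h hi]
    omega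

/-- A sequence of natural numbers with steps `±1` and no peak first decreases, then increases. -/
lemma exists_eq_add_dist_of_no_peak (f : ℕ → ℕ) (d : ℕ)
    (hstep : ∀ i < d, f i = f (i + 1) + 1 ∨ f (i + 1) = f i + 1)
    (hpeak : ∀ i, i + 2 ≤ d → ¬ (f i < f (i + 1) ∧ f (i + 2) < f (i + 1))) :
    ∃ j ≤ d, ∀ i ≤ d, f i = f j + ((i - j) + (j - i)) := by
  induction d with
  | zero =>
    refine ⟨0, le_rfl, fun i hi => ?_⟩
    obtain rfl : i = 0 := by omega
    simp
  | succ d ih =>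
    obtain ⟨j, hj, hf⟩ := ih (fun i hi => hstep i (by omega)) (fun i hi => hpeak i (by omega))
    have hd := hf d le_rfl
    rcases hstep d (by omega) with h | h
    -- A final descent after an earlier ascent would create a peak at `d`.
    · have hjd : j = d := by
        by_contra hne
        obtain ⟨e, rfl⟩ : ∃ e, d = e + 1 := ⟨d - 1, by omega⟩
        have := hf e (by omega)
        replace h : f (e + 1) = f (e + 2) + 1 := h
        exact hpeak e (by omega) ⟨by omega, by omega⟩
      subst hjd
      refine ⟨j + 1, le_rfl, fun i hi => ?_⟩
      rcases Nat.lt_or_ge i (j + 1) with h1 | h1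
      · have := hf i (by omega)
        omega
      · obtain rfl : i = j + 1 := by omega
        omega
    · refine ⟨j, by omega, fun i hi => ?_⟩
      rcases Nat.lt_or_ge i (d + 1) with h1 | h1
      · exact hf i (by omega)
      · obtain rfl : i = d + 1 := by omega
        omega

/-- In a tree, the distances from a vertex to a geodesic path are determined by the
distance to the path and the point of the path that is nearest. -/
lemma IsTree.exists_dist_geodesic (hG : G.IsTree) {d : ℕ} {p : ℕ → V} (hp : G.IsGeodesic d p)
    (x : V) : ∃ j ≤ d, ∀ i ≤ d, G.dist x (p i) = G.dist x (p j) + ((i - j) + (j - i)) := by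
  refine exists_eq_add_dist_of_no_peak (fun i => G.dist x (p i)) d (fun i hi => ?_)
    (fun i hi h => ?_)
  · exact hG.dist_eq_dist_add_one_of_adj x (hp.adj hi)
  -- A peak would give `p (i + 1)` two neighbours closer to `x`.
  · have := hG.eq_of_adj_of_dist_lt (hp.adj (i := i) (by omega))
      (hp.adj (i := i + 1) (by omega)).symm h.1 h.2
    have := hp.eq_of_eq (by omega) hi this
    omega

/-- Vertices hanging off adjacent vertices of a geodesic are at distance at least `3`. -/
lemma IsTree.two_lt_dist_of_adj_geodesic (hG : G.IsTree) {d : ℕ} {p : ℕ → V}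
    (hp : G.IsGeodesic d p) {x y : V} {c : ℕ} (hc : c + 1 ≤ d)
    (hx : ∀ i ≤ d, G.dist x (p i) = 1 + ((i - c) + (c - i)))
    (hy : G.Adj y (p (c + 1))) (hyc : y ≠ p c) : 2 < G.dist x y := by
  have h1 := hx (c + 1) hc
  have h0 := hx c (by omega)
  rcases hG.dist_eq_dist_add_one_of_adj x hy with h | h
  · omega
  · exact absurd (hG.eq_of_adj_of_dist_lt (x := x) hy (hp.adj (by omega)) (by omega) (by omega)) hyc

end SimpleGraph

/-! ### Distance sums against a path -/

namespace WienerIndices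

open Finset

/-- The sum of `f` over the distances from a vertex to the vertices of a path of length `d`, when
the vertex is at distance `h` from the path and its nearest point is the `j`-th one. -/
noncomputable def pathSum (f : ℕ → ℝ) (d h j : ℕ) : ℝ :=
  ∑ i ∈ range (d + 1), f (h + ((i - j) + (j - i)))

lemma pathSum_reflect (f : ℕ → ℝ) {d j : ℕ} (h : ℕ) (hj : j ≤ d) :
    pathSum f d h (d - j) = pathSum f d h j := by
  unfold pathSum
  rw [← sum_range_reflect]
  refine sum_congr rfl fun i hi => ?_
  rw [mem_range] at hi
  congr 1
  omega

lemma pathSum_eq_add (f : ℕ → ℝ) {d j : ℕ} (h : ℕ) (hj : j ≤ d) :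
    pathSum f d h j =
      (∑ k ∈ range j, f (h + (k + 1))) + ∑ k ∈ range (d - j + 1), f (h + k) := by
  unfold pathSum
  rw [show d + 1 = j + (d - j + 1) by omega, sum_range_add, ← sum_range_reflect]
  congr 1 <;> refine sum_congr rfl fun i hi => ?_ <;> rw [mem_range] at hi <;> congr 1 <;> omega

/-- Moving the nearest point one step lengthens one arm and shortens the other, so only the two end
terms change. -/
lemma pathSum_sub_succ (f : ℕ → ℝ) {d j : ℕ} (h : ℕ) (hj : j + 1 ≤ d) :
    pathSum f d h j - pathSum f d h (j + 1) = f (h + (d - j)) - f (h + (j + 1)) := by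
  rw [pathSum_eq_add f h (by omega), pathSum_eq_add f h hj, sum_range_succ _ j,
    show d - j + 1 = (d - (j + 1) + 1) + 1 by omega, sum_range_succ _ (d - (j + 1) + 1),
    show d - (j + 1) + 1 = d - j by omega]
  ring

/-- A function nondecreasing from `1` on, constant on `{1, 2}` and strictly increasing from `2`
on. -/
structure StrictFromTwo (f : ℕ → ℝ) : Prop where
  one_eq_two : f 1 = f 2
  lt_of_lt : ∀ ⦃a b⦄, 2 ≤ a → a < b → f a < f b

lemma StrictFromTwo.le_of_le {f : ℕ → ℝ} (hf : StrictFromTwo f) {a b : ℕ} (ha : 1 ≤ a)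
    (hab : a ≤ b) : f a ≤ f b := by
  rcases hab.eq_or_lt with rfl | hab
  · exact le_rfl
  rcases Nat.lt_or_ge 1 a with h | h
  · exact (hf.lt_of_lt h hab).le
  · obtain rfl : a = 1 := by omega
    rcases Nat.lt_or_ge 2 b with h2 | h2
    · exact hf.one_eq_two.trans_le (hf.lt_of_lt le_rfl h2).le
    · obtain rfl : b = 2 := by omega
      exact hf.one_eq_two.le

/-- Each of the `k` steps towards the centre trades the end term of the longer arm for a smaller
one. With `h = 1` both arguments are at least 2, where `f` is strict. -/
lemma pathSum_center_lt {f : ℕ → ℝ} (hf : StrictFromTwo f) {d j k : ℕ}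
    (hj : j + k = d / 2) (hk : k ≠ 0) : pathSum f d 1 (d / 2) < pathSum f d 1 j := by
  induction k generalizing j with
  | zero => exact absurd rfl hk
  | succ k ih =>
    have h1 := pathSum_sub_succ f (d := d) (j := j) 1 (by omega)
    have h2 : f (1 + (j + 1)) < f (1 + (d - j)) := hf.lt_of_lt (by omega) (by omega)
    rcases Nat.eq_zero_or_pos k with rfl | hk
    · rw [← hj]
      simp only [zero_add] at *
      linarith
    · have := ih (j := j + 1) (by omega) (by omega)
      linarith

lemma pathSum_center_lt_of_ne {f : ℕ → ℝ} (hf : StrictFromTwo f) {d j : ℕ} (hj : j ≤ d)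
    (h1 : j ≠ d / 2) (h2 : j ≠ d - d / 2) : pathSum f d 1 (d / 2) < pathSum f d 1 j := by
  rcases Nat.lt_or_ge j (d / 2) with h | h
  · exact pathSum_center_lt hf (k := d / 2 - j) (by omega) (by omega)
  · rw [← pathSum_reflect f 1 hj]
    exact pathSum_center_lt hf (k := d / 2 - (d - j)) (by omega) (by omega)

lemma pathSum_center_le {f : ℕ → ℝ} (hf : StrictFromTwo f) {d j : ℕ} (hj : j ≤ d) :
    pathSum f d 1 (d / 2) ≤ pathSum f d 1 j := by
  by_cases h1 : j = d / 2
  · rw [h1]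
  by_cases h2 : j = d - d / 2
  · rw [h2, pathSum_reflect f 1 (by omega)]
  exact (pathSum_center_lt_of_ne hf hj h1 h2).le

lemma pathSum_one_le {f : ℕ → ℝ} (hf : StrictFromTwo f) {d h j : ℕ} (hh : 1 ≤ h) :
    pathSum f d 1 j ≤ pathSum f d h j :=
  sum_le_sum fun _ _ => hf.le_of_le (by omega) (by omega)

lemma pathSum_one_lt {f : ℕ → ℝ} (hf : StrictFromTwo f) {d h j : ℕ} (hd : 1 ≤ d) (hh : 1 < h) :
    pathSum f d 1 j < pathSum f d h j := by
  refine sum_lt_sum (fun _ _ => hf.le_of_le (by omega) (by omega))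
    -- Any index other than `j` works: it makes both arguments at least 2. At `j` itself strictness
    -- can fail because `f 1 = f 2`.
    ⟨if j = 0 then 1 else 0, ?_, ?_⟩
  · rw [mem_range]
    split <;> omega
  · apply hf.lt_of_lt <;> split <;> omega

lemma eq_of_pathSum_eq {f : ℕ → ℝ} (hf : StrictFromTwo f) {d h j : ℕ} (hd : 1 ≤ d) (hh : 1 ≤ h)
    (hj : j ≤ d) (heq : pathSum f d 1 (d / 2) = pathSum f d h j) :
    h = 1 ∧ (j = d / 2 ∨ j = d - d / 2) := by
  have hle := pathSum_center_le hf hj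
  have h1 : h = 1 := by
    by_contra hne
    have := pathSum_one_lt hf hd (j := j) (show 1 < h by omega)
    linarith
  subst h1
  refine ⟨rfl, ?_⟩
  by_contra! hne
  have := pathSum_center_lt_of_ne hf hj hne.1 hne.2
  linarith

end WienerIndices

/-! ### The lower bound and its equality case -/

namespace WienerIndices

open Finset SimpleGraph

variable {V : Type*} [Fintype V]

/-- The sum of `f (d(u, v))` over all ordered pairs `(u, v)` of vertices. -/
noncomputable def pairSum (G : SimpleGraph V) (f : ℕ → ℝ) : ℝ :=
  ∑ x : V, ∑ y : V, f (G.dist x y)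

open Classical in
/-- The vertices that are not among `p 0, …, p d`. -/
noncomputable def offPath (d : ℕ) (p : ℕ → V) : Finset V :=
  ((range (d + 1)).image p)ᶜ

lemma mem_offPath {d : ℕ} {p : ℕ → V} {x : V} : x ∈ offPath d p ↔ ∀ i ≤ d, p i ≠ x := by
  simp [offPath]

lemma sum_eq_sum_path_add {G : SimpleGraph V} {d : ℕ} {p : ℕ → V} (hp : G.IsGeodesic d p)
    (F : V → ℝ) :
    ∑ x, F x = ∑ i ∈ range (d + 1), F (p i) + ∑ x ∈ offPath d p, F x := by
  classical
  rw [offPath, ← sum_add_sum_compl ((range (d + 1)).image p), sum_image]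
  intro i hi j hj h
  simp only [coe_range, Set.mem_Iio] at hi hj
  exact hp.eq_of_eq (by omega) (by omega) h

lemma card_offPath {G : SimpleGraph V} {d : ℕ} {p : ℕ → V} (hp : G.IsGeodesic d p) :
    (#(offPath d p) : ℝ) = Fintype.card V - (d + 1) := by
  have := sum_eq_sum_path_add hp fun _ => 1
  simp only [sum_const, card_univ, card_range, nsmul_eq_mul, mul_one] at this
  push_cast at this
  linarith

lemma pairSum_eq {G : SimpleGraph V} {d : ℕ} {p : ℕ → V} (hp : G.IsGeodesic d p) (f : ℕ → ℝ) :
    pairSum G f =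
      ∑ i ∈ range (d + 1), pathSum f d 0 i +
      2 * ∑ x ∈ offPath d p, ∑ i ∈ range (d + 1), f (G.dist x (p i)) +
      ∑ x ∈ offPath d p, ∑ y ∈ offPath d p, f (G.dist x y) := by
  have h1 : ∀ i ∈ range (d + 1), ∑ y, f (G.dist (p i) y) =
      pathSum f d 0 i + ∑ y ∈ offPath d p, f (G.dist y (p i)) := by
    intro i hi
    rw [sum_eq_sum_path_add hp, pathSum]
    congr 1
    · refine sum_congr rfl fun j hj => ?_
      rw [mem_range] at hi hj
      rw [dist_comm, hp j (by omega) i (by omega), zero_add]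
    · exact sum_congr rfl fun y _ => by rw [dist_comm]
  have h2 : ∀ x, ∑ y, f (G.dist x y) = ∑ i ∈ range (d + 1), f (G.dist x (p i)) +
      ∑ y ∈ offPath d p, f (G.dist x y) := fun x => sum_eq_sum_path_add hp _
  rw [pairSum, sum_eq_sum_path_add hp, sum_congr rfl h1, sum_congr rfl fun x _ => h2 x,
    sum_add_distrib, sum_add_distrib, sum_comm (s := range (d + 1))]
  ring

/-- The value of `pairSum` for a tree with `n` vertices that has a geodesic path of length `d` and
whose remaining vertices are adjacent to a centre of the path. -/
noncomputable def extremalPairSum (d n : ℕ) (f : ℕ → ℝ) : ℝ :=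
  ∑ i ∈ range (d + 1), pathSum f d 0 i +
  2 * (((n : ℝ) - (d + 1)) * pathSum f d 1 (d / 2)) +
  ((n : ℝ) - (d + 1)) * (f 0 + ((n : ℝ) - (d + 1) - 1) * f 2)

open Classical in
lemma sum_sum_ite_eq {α : Type*} (s : Finset α) (a b : ℝ) :
    ∑ x ∈ s, ∑ y ∈ s, (if x = y then a else b) = #s * (a + ((#s : ℝ) - 1) * b) := by
  rw [← nsmul_eq_mul, ← sum_const]
  refine sum_congr rfl fun x hx => ?_
  have : ∀ y ∈ s, (if x = y then a else b) = (if x = y then a - b else 0) + b := by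
    intro y _
    split <;> ring
  rw [sum_congr rfl this, sum_add_distrib, sum_ite_eq, if_pos hx, sum_const, nsmul_eq_mul]
  ring

-- This is where `f 1 = f 2` is needed: adjacent vertices also cost `f 2`.
open Classical in
lemma ite_le_dist {V : Type*} {T : SimpleGraph V} {f : ℕ → ℝ} (hT : T.IsTree) (hf : StrictFromTwo f) (x y : V) :
    (if x = y then f 0 else f 2) ≤ f (T.dist x y) := by
  split_ifs with h
  · rw [h, dist_self]
  · have := hT.1.pos_dist_of_ne h
    rw [← hf.one_eq_two]
    exact hf.le_of_le le_rfl this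

section Bound

variable {T : SimpleGraph V} {d : ℕ} {p : ℕ → V} {f : ℕ → ℝ}

lemma exists_sum_dist_eq_pathSum (hT : T.IsTree) (hp : T.IsGeodesic d p) {x : V}
    (hx : x ∈ offPath d p) :
    ∃ h j, 1 ≤ h ∧ j ≤ d ∧ (∀ i ≤ d, T.dist x (p i) = h + ((i - j) + (j - i))) ∧
      ∑ i ∈ range (d + 1), f (T.dist x (p i)) = pathSum f d h j := by
  obtain ⟨j, hj, hdist⟩ := hT.exists_dist_geodesic hp x
  refine ⟨T.dist x (p j), j, ?_, hj, hdist, sum_congr rfl fun i hi => ?_⟩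
  · exact hT.1.pos_dist_of_ne (mem_offPath.1 hx j hj).symm
  · rw [mem_range] at hi
    rw [hdist i (by omega)]

lemma pathSum_le_sum_dist (hT : T.IsTree) (hp : T.IsGeodesic d p) (hf : StrictFromTwo f) {x : V}
    (hx : x ∈ offPath d p) :
    pathSum f d 1 (d / 2) ≤ ∑ i ∈ range (d + 1), f (T.dist x (p i)) := by
  obtain ⟨h, j, hh, hj, -, heq⟩ := exists_sum_dist_eq_pathSum (f := f) hT hp hx
  rw [heq]
  exact (pathSum_center_le hf hj).trans (pathSum_one_le hf hh)

lemma extremalPairSum_eq (hp : T.IsGeodesic d p) [DecidableEq V] (f : ℕ → ℝ) :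
    extremalPairSum d (Fintype.card V) f =
      ∑ i ∈ range (d + 1), pathSum f d 0 i +
      2 * ∑ _x ∈ offPath d p, pathSum f d 1 (d / 2) +
      ∑ x ∈ offPath d p, ∑ y ∈ offPath d p, (if x = y then f 0 else f 2) := by
  rw [extremalPairSum, sum_const, nsmul_eq_mul, ← card_offPath hp, ← sum_sum_ite_eq]
  congr!

lemma extremalPairSum_le (hT : T.IsTree) (hp : T.IsGeodesic d p) (hf : StrictFromTwo f) :
    extremalPairSum d (Fintype.card V) f ≤ pairSum T f := by
  classical
  rw [extremalPairSum_eq hp, pairSum_eq hp]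
  gcongr with x hx x hx y hy
  · exact pathSum_le_sum_dist hT hp hf hx
  · convert ite_le_dist hT hf x y

/-- The bound holds term by term, so equal totals force equality in every term. -/
lemma of_pairSum_eq (hT : T.IsTree) (hp : T.IsGeodesic d p) (hf : StrictFromTwo f)
    (heq : pairSum T f = extremalPairSum d (Fintype.card V) f) :
    (∀ x ∈ offPath d p, pathSum f d 1 (d / 2) = ∑ i ∈ range (d + 1), f (T.dist x (p i))) ∧
    ∀ x ∈ offPath d p, ∀ y ∈ offPath d p, T.dist x y ≤ 2 := by
  classical
  rw [extremalPairSum_eq hp, pairSum_eq hp] at heq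
  have h1 := sum_le_sum fun x hx => pathSum_le_sum_dist (f := f) (x := x) hT hp hf hx
  have h2 : ∀ x ∈ offPath d p, ∑ y ∈ offPath d p, (if x = y then f 0 else f 2) ≤
      ∑ y ∈ offPath d p, f (T.dist x y) :=
    fun x _ => sum_le_sum fun y _ => by convert ite_le_dist hT hf x y
  have h3 := sum_le_sum h2
  refine ⟨(sum_eq_sum_iff_of_le fun x hx => pathSum_le_sum_dist hT hp hf hx).1 (by linarith),
    fun x hx y hy => ?_⟩
  have h4 := (sum_eq_sum_iff_of_le h2).1 (by linarith) x hx
  have h5 := (sum_eq_sum_iff_of_le (f := fun y => if x = y then f 0 else f 2)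
    (g := fun y => f (T.dist x y)) fun y _ => by convert ite_le_dist hT hf x y).1 h4 y hy
  split_ifs at h5 with hxy
  · simp [hxy]
  · by_contra! hlt
    exact (hf.lt_of_lt le_rfl hlt).ne h5

/-- The vertices `p 0, …, p d` form a geodesic path and all other vertices are adjacent to
the centre `p (d / 2)`. -/
structure IsSpider (T : SimpleGraph V) (d : ℕ) (p : ℕ → V) : Prop where
  isGeodesic : T.IsGeodesic d p
  adj : ∀ x ∈ offPath d p, T.Adj x (p (d / 2))

lemma IsSpider.dist_path (hp : IsSpider T d p) (hT : T.IsTree) {x : V} (hx : x ∈ offPath d p)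
    {i : ℕ} (hi : i ≤ d) : T.dist x (p i) = 1 + ((i - d / 2) + (d / 2 - i)) := by
  obtain ⟨h, j, hh, hj, hdist, -⟩ :=
    exists_sum_dist_eq_pathSum (f := fun _ => 0) hT hp.isGeodesic hx
  have hadj := hp.adj x hx
  rw [← dist_eq_one_iff_adj, hdist _ (by omega)] at hadj
  obtain rfl : j = d / 2 := by omega
  rw [hdist i hi]
  omega

lemma IsSpider.dist_off (hp : IsSpider T d p) (hT : T.IsTree) {x y : V} (hx : x ∈ offPath d p)
    (hy : y ∈ offPath d p) (hxy : x ≠ y) : T.dist x y = 2 := by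
  have hxc := dist_eq_one_iff_adj.2 (hp.adj x hx)
  rcases hT.dist_eq_dist_add_one_of_adj x (hp.adj y hy) with h | h
  · omega
  · have := hT.1.pos_dist_of_ne hxy
    omega

lemma IsSpider.pairSum_eq_extremalPairSum (hp : IsSpider T d p) (hT : T.IsTree) (f : ℕ → ℝ) :
    pairSum T f = extremalPairSum d (Fintype.card V) f := by
  classical
  rw [extremalPairSum_eq hp.isGeodesic, pairSum_eq hp.isGeodesic]
  have h1 : ∀ x ∈ offPath d p,
      ∑ i ∈ range (d + 1), f (T.dist x (p i)) = pathSum f d 1 (d / 2) := by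
    intro x hx
    refine sum_congr rfl fun i hi => ?_
    rw [mem_range] at hi
    rw [hp.dist_path hT hx (by omega)]
  have h2 : ∀ x ∈ offPath d p, ∀ y ∈ offPath d p,
      f (T.dist x y) = if x = y then f 0 else f 2 := by
    intro x hx y hy
    split_ifs with h
    · rw [h, dist_self]
    · rw [hp.dist_off hT hx hy h]
  rw [sum_congr rfl h1, sum_congr rfl fun x hx => sum_congr rfl (h2 x hx)]

lemma exists_isSpider_of_pairSum_eq (hT : T.IsTree) (hp : T.IsGeodesic d p) (hd : 1 ≤ d)
    (hf : StrictFromTwo f) (heq : pairSum T f = extremalPairSum d (Fintype.card V) f) :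
    ∃ q, IsSpider T d q := by
  obtain ⟨h1, h2⟩ := of_pairSum_eq hT hp hf heq
  have h3 : ∀ x ∈ offPath d p, ∃ j, (j = d / 2 ∨ j = d - d / 2) ∧
      ∀ i ≤ d, T.dist x (p i) = 1 + ((i - j) + (j - i)) := by
    intro x hx
    obtain ⟨h, j, hh, hj, hdist, hsum⟩ := exists_sum_dist_eq_pathSum (f := f) hT hp hx
    obtain ⟨rfl, hj'⟩ := eq_of_pathSum_eq hf hd hh hj ((h1 x hx).trans hsum)
    exact ⟨j, hj', hdist⟩
  by_cases hall : ∀ x ∈ offPath d p, T.Adj x (p (d / 2))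
  · exact ⟨p, hp, hall⟩
  push Not at hall
  obtain ⟨x, hx, hnadj⟩ := hall
  have hfar : ∀ z ∈ offPath d p, ¬ T.Adj z (p (d / 2)) → T.Adj z (p (d - d / 2)) := by
    intro z hz hnz
    obtain ⟨j, rfl | rfl, hj⟩ := h3 z hz
    · refine absurd (dist_eq_one_iff_adj.1 ?_) hnz
      rw [hj _ (by omega)]
      omega
    · rw [← dist_eq_one_iff_adj, hj _ (by omega)]
      omega
  -- Reversal moves the other centre to position `d / 2`. A vertex `y` not hanging there hangs from
  -- the first centre, hence is too far from `x`.
  refine ⟨fun i => p (d - i), hp.reverse, fun y hy => ?_⟩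
  have hy' : y ∈ offPath d p := by
    rw [mem_offPath] at hy ⊢
    intro i hi
    have := hy (d - i) (by omega)
    rwa [show d - (d - i) = i by omega] at this
  by_contra hny
  have hyc : T.Adj y (p (d / 2)) := by
    by_contra h
    exact hny (hfar y hy' h)
  have hodd : d - d / 2 = d / 2 + 1 := by
    by_contra hne
    exact hnadj ((show d - d / 2 = d / 2 by omega) ▸ hfar x hx hnadj)
  obtain ⟨j, hj, hdist⟩ := h3 y hy'
  have hyd := dist_eq_one_iff_adj.2 hyc
  rw [hdist _ (by omega)] at hyd
  obtain rfl : j = d / 2 := by omega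
  have := hT.two_lt_dist_of_adj_geodesic hp (by omega) hdist (hodd ▸ hfar x hx hnadj)
    (mem_offPath.1 hx _ (by omega)).symm
  have := h2 y hy' x hx
  omega

lemma IsSpider.adj_iff_of_mem_offPath (hp : IsSpider T d p) (hT : T.IsTree) {x : V}
    (hx : x ∈ offPath d p) (y : V) : T.Adj x y ↔ y = p (d / 2) := by
  refine ⟨fun h => ?_, fun h => h ▸ hp.adj x hx⟩
  have hd := dist_eq_one_iff_adj.2 h
  by_cases hy : y ∈ offPath d p
  · rw [hp.dist_off hT hx hy h.ne] at hd
    omega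
  · simp only [mem_offPath, not_forall, not_not] at hy
    obtain ⟨i, hi, rfl⟩ := hy
    rw [hp.dist_path hT hx hi] at hd
    congr 1
    omega

/-- Any bijection extending `p i ↦ q i` works, since a vertex off the path has the centre as its
only neighbour. -/
lemma IsSpider.nonempty_iso (hp : IsSpider T d p) (hT : T.IsTree) {W : Type*} [Fintype W]
    {S : SimpleGraph W} {q : ℕ → W} (hq : IsSpider S d q) (hS : S.IsTree)
    (hcard : Fintype.card V = Fintype.card W) : Nonempty (T ≃g S) := by
  classical
  -- The distance to `p 0` recovers the index of a path vertex, so no inverse of `p` is needed.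
  have hF : ∀ i ≤ d, q (T.dist (p 0) (p i)) = q i := by
    intro i hi
    rw [hp.isGeodesic 0 (by omega) i hi]
    congr 1
    omega
  obtain ⟨e, he⟩ := Finset.exists_equiv_extend_of_card_eq (t := (univ : Finset W))
    (by rw [hcard, card_univ]) (s := (range (d + 1)).image p)
    (f := fun x => q (T.dist (p 0) x)) (subset_univ _) (by
      intro x hx y hy hxy
      simp only [coe_image, coe_range, Set.mem_image, Set.mem_Iio] at hx hy
      obtain ⟨i, hi, rfl⟩ := hx
      obtain ⟨j, hj, rfl⟩ := hy
      simp only [hF i (by omega), hF j (by omega)] at hxy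
      rw [hq.isGeodesic.eq_of_eq (by omega) (by omega) hxy])
  let φ : V ≃ W := e.trans (Equiv.subtypeUnivEquiv mem_univ)
  have hφ : ∀ i ≤ d, φ (p i) = q i := by
    intro i hi
    rw [← hF i hi]
    exact he _ (mem_image_of_mem p (mem_range.2 (by omega)))
  have hoff : ∀ x ∈ offPath d p, φ x ∈ offPath d q := by
    intro x hx
    rw [mem_offPath] at hx ⊢
    intro i hi h
    rw [← hφ i hi] at h
    exact hx i hi (φ.injective h)
  have hleft : ∀ x ∈ offPath d p, ∀ y, S.Adj (φ x) (φ y) ↔ T.Adj x y := by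
    intro x hx y
    rw [hq.adj_iff_of_mem_offPath hS (hoff x hx), hp.adj_iff_of_mem_offPath hT hx,
      ← hφ _ (by omega), φ.injective.eq_iff]
  refine ⟨⟨φ, @fun x y => ?_⟩⟩
  by_cases hx : x ∈ offPath d p
  · exact hleft x hx y
  by_cases hy : y ∈ offPath d p
  · rw [S.adj_comm, T.adj_comm]
    exact hleft y hy x
  simp only [mem_offPath, not_forall, not_not] at hx hy
  obtain ⟨i, hi, rfl⟩ := hx
  obtain ⟨j, hj, rfl⟩ := hy
  rw [hφ i hi, hφ j hj, ← dist_eq_one_iff_adj, ← dist_eq_one_iff_adj, hq.isGeodesic i hi j hj,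
    hp.isGeodesic i hi j hj]

end Bound

end WienerIndices

/-! ### Unordered pairs and changes of weight -/

namespace WienerIndices

open Finset SimpleGraph

section Wiener

variable {V : Type*} [Fintype V]

lemma pairSum_eq_two_mul_wienerType_add (G : SimpleGraph V) (g : ℕ → ℝ) :
    pairSum G g = 2 * wienerType G g + Fintype.card V * g 0 := by
  -- An arbitrary order selects one orientation of each unordered pair.
  let _ : LinearOrder V := LinearOrder.lift' (Fintype.equivFin V) (Fintype.equivFin V).injective
  have h1 : wienerType G g = ∑ q : V × V, if q.1 < q.2 then g (G.dist q.1 q.2) else 0 := by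
    have h := sum_sym2_filter_not_isDiag (univ : Finset V) fun e => g (pairDist G e)
    rw [sym2_univ] at h
    rw [← sum_filter, wienerType]
    refine Eq.trans (by congr!) (h.trans (sum_congr ?_ fun _ _ => rfl))
    ext q
    simp only [mem_filter, mem_univ, true_and, mem_offDiag]
    exact ⟨fun h => h.2, fun h => ⟨h.ne, h⟩⟩
  have h2 : wienerType G g = ∑ q : V × V, if q.2 < q.1 then g (G.dist q.1 q.2) else 0 := by
    rw [h1, ← (Equiv.prodComm V V).sum_comp]
    refine sum_congr rfl fun q _ => ?_
    simp [G.dist_comm]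
  have h3 : (Fintype.card V * g 0 : ℝ) =
      ∑ q : V × V, if q.1 = q.2 then g (G.dist q.1 q.2) else 0 := by
    rw [Fintype.sum_prod_type]
    simp
  rw [two_mul, h3]
  nth_rw 1 [h1]
  rw [h2, pairSum, ← Fintype.sum_prod_type', ← sum_add_distrib, ← sum_add_distrib]
  refine sum_congr rfl fun q _ => ?_
  rcases lt_trichotomy q.1 q.2 with h | h | h
  · simp [h, h.ne, h.not_gt]
  · simp [h]
  · simp [h, h.ne', h.not_gt]

lemma wienerType_congr {G : SimpleGraph V} {g g' : ℕ → ℝ}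
    (h : ∀ u v, u ≠ v → g (G.dist u v) = g' (G.dist u v)) : wienerType G g = wienerType G g' := by
  classical
  refine sum_congr rfl fun e he => ?_
  induction e with
  | _ u v =>
    rw [mem_filter, Sym2.mk_isDiag_iff] at he
    exact h u v he.2

lemma wienerType_neg (G : SimpleGraph V) (g : ℕ → ℝ) :
    wienerType G (fun k => -g k) = -wienerType G g := by
  rw [wienerType, wienerType, sum_neg_distrib]

lemma dist_le_of_hom {V W : Type*} {G : SimpleGraph V} {H : SimpleGraph W} (hG : G.Connected)
    (φ : G →g H) (u v : V) : H.dist (φ u) (φ v) ≤ G.dist u v := by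
  obtain ⟨w, hw⟩ := hG.exists_walk_length_eq_dist u v
  rw [← hw, ← w.length_map φ]
  exact dist_le _

lemma wienerType_eq_of_iso {W : Type*} [Fintype W] {G : SimpleGraph V} {H : SimpleGraph W}
    (hG : G.Connected) (hH : H.Connected) (φ : G ≃g H) (g : ℕ → ℝ) :
    wienerType G g = wienerType H g := by
  have hdist : ∀ u v, H.dist (φ u) (φ v) = G.dist u v := by
    intro u v
    refine (dist_le_of_hom hG φ.toHom u v).antisymm ?_
    have := dist_le_of_hom hH φ.symm.toHom (φ u) (φ v)
    simpa using this
  have hsum : pairSum G g = pairSum H g := by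
    rw [pairSum, pairSum, ← φ.toEquiv.sum_comp]
    refine sum_congr rfl fun u _ => ?_
    rw [← φ.toEquiv.sum_comp]
    exact sum_congr rfl fun v _ => by rw [← hdist u v]; rfl
  rw [pairSum_eq_two_mul_wienerType_add, pairSum_eq_two_mul_wienerType_add,
    Fintype.card_congr φ.toEquiv] at hsum
  linarith

/-- In a tree, the number of pairs at distance `1` only depends on the order. -/
lemma pairSum_add_ite_of_isTree {T : SimpleGraph V} (hT : T.IsTree) (g : ℕ → ℝ) (a : ℝ) :
    pairSum T (fun k => g k + if k = 1 then a else 0) =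
      pairSum T g + 2 * (Fintype.card V - 1) * a := by
  classical
  have hcard : (#T.edgeFinset : ℝ) = Fintype.card V - 1 := by
    rw [← hT.card_edgeFinset]
    push_cast
    ring
  have hdeg : (∑ x, (T.degree x : ℝ)) = 2 * #T.edgeFinset := by
    exact_mod_cast T.sum_degrees_eq_twice_card_edges
  have hx : ∀ x, ∑ y, (if T.dist x y = 1 then a else 0) = T.degree x * a := by
    intro x
    rw [← sum_filter, sum_const, nsmul_eq_mul, ← T.card_neighborFinset_eq_degree]
    congr 3
    ext y
    simp
  simp only [pairSum, sum_add_distrib, hx, ← sum_mul, hdeg, hcard]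

lemma strictFromTwo_add_ite {g : ℕ → ℝ} (hg : StrictMono g) :
    StrictFromTwo fun k => g k + if k = 1 then g 2 - g 1 else 0 where
  one_eq_two := by simp
  lt_of_lt a b ha hab := by
    simp only [show a ≠ 1 by omega, show b ≠ 1 by omega, if_false, add_zero]
    exact hg hab

/-- Only distances `1, …, d` occur, so other values of the weight may be replaced. The reciprocal
complementary weight, for one, stops increasing after `d`. -/
lemma exists_strictMono_eqOn {g : ℕ → ℝ} {d : ℕ} (hd : 1 ≤ d)
    (hg : StrictMonoOn g (Set.Icc 1 d)) :
    ∃ g' : ℕ → ℝ, StrictMono g' ∧ Set.EqOn g g' (Set.Icc 1 d) := by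
  refine ⟨fun k => if k = 0 then g 1 - 1 else if k ≤ d then g k else g d + (k - d),
    strictMono_nat_of_lt_succ fun k => ?_, fun k hk => ?_⟩
  · rcases Nat.eq_zero_or_pos k with rfl | hk
    · simp [hd]
    rcases lt_trichotomy k d with h | rfl | h
    · have := hg ⟨hk, h.le⟩ ⟨Nat.le_add_left 1 k, h⟩ (Nat.lt_succ_self k)
      simpa [hk.ne', h.le, Nat.succ_le_of_lt h] using this
    · simp [hk.ne']
    · simp [hk.ne', h.not_ge, show ¬ k + 1 ≤ d by omega]
  · simp [show k ≠ 0 from (Nat.lt_of_lt_of_le Nat.zero_lt_one hk.1).ne', hk.2]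

lemma dist_mem_Icc {T : SimpleGraph V} (hT : T.Connected) {u v : V} (h : u ≠ v) :
    T.dist u v ∈ Set.Icc 1 T.diam := by
  have := hT.nonempty
  exact ⟨hT.pos_dist_of_ne h, dist_le_diam (connected_iff_ediam_ne_top.1 hT)⟩

end Wiener

/-! ### The model tree -/

section DiamTree

variable {d n : ℕ}

/-- The vertices of the path `0, 1, …, d` in `diamTree d n`. -/
def diamPath (hn : 0 < n) (i : ℕ) : Fin n :=
  if h : i < n then ⟨i, h⟩ else ⟨0, hn⟩

lemma diamPath_val (hn : 0 < n) {i : ℕ} (hi : i < n) : (diamPath hn i : ℕ) = i := by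
  simp [diamPath, hi]

lemma diamTree_adj {u v : Fin n} : (diamTree d n).Adj u v ↔ u ≠ v ∧
    ((((u : ℕ) + 1 = v ∧ (v : ℕ) ≤ d) ∨ ((u : ℕ) = d / 2 ∧ d < (v : ℕ))) ∨
      (((v : ℕ) + 1 = u ∧ (u : ℕ) ≤ d) ∨ ((v : ℕ) = d / 2 ∧ d < (u : ℕ)))) :=
  fromRel_adj _ _ _

/-- The neighbour of a vertex `v ≠ 0` of `diamTree d n` on the way to `0`. -/
def diamParent (hn : 0 < n) (d : ℕ) (v : Fin n) : Fin n :=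
  diamPath hn (if (v : ℕ) ≤ d then (v : ℕ) - 1 else d / 2)

lemma diamParent_val (hn : 0 < n) (v : Fin n) :
    (diamParent hn d v : ℕ) = if (v : ℕ) ≤ d then (v : ℕ) - 1 else d / 2 := by
  apply diamPath_val
  have := v.2
  split <;> omega

lemma diamTree_adj_parent (hn : 0 < n) {v : Fin n} (hv : (v : ℕ) ≠ 0) :
    (diamTree d n).Adj v (diamParent hn d v) := by
  rw [diamTree_adj, ne_eq, Fin.ext_iff, diamParent_val]
  split <;> omega

lemma diamTree_connected (hn : 0 < n) : (diamTree d n).Connected := by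
  have key : ∀ k, ∀ v : Fin n, (v : ℕ) = k → (diamTree d n).Reachable v ⟨0, hn⟩ := by
    intro k
    induction k using Nat.strong_induction_on with
    | _ k ih =>
      intro v hv
      by_cases h0 : (v : ℕ) = 0
      · rw [show v = ⟨0, hn⟩ from Fin.ext h0]
      · refine (diamTree_adj_parent hn h0).reachable.trans (ih _ ?_ _ rfl)
        rw [diamParent_val]
        split <;> omega
  have : Nonempty (Fin n) := ⟨⟨0, hn⟩⟩
  exact ⟨fun u v => (key _ u rfl).trans (key _ v rfl).symm⟩

lemma diamTree_isTree (hn : 0 < n) : (diamTree d n).IsTree := by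
  have hconn := diamTree_connected (d := d) hn
  refine isTree_iff_connected_and_card.2 ⟨hconn, le_antisymm ?_ ?_⟩
  -- Every edge joins a nonzero vertex to its parent, which leaves at most `n - 1` edges.
  · have hsub : (diamTree d n).edgeSet ⊆
        (fun v => s(v, diamParent hn d v)) '' ({⟨0, hn⟩}ᶜ : Set (Fin n)) := by
      intro e he
      induction e with
      | _ u v =>
        rw [mem_edgeSet, diamTree_adj] at he
        have key : ∀ u v : Fin n,
            ((u : ℕ) + 1 = v ∧ (v : ℕ) ≤ d) ∨ ((u : ℕ) = d / 2 ∧ d < (v : ℕ)) →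
            v ∈ ({⟨0, hn⟩}ᶜ : Set (Fin n)) ∧ diamParent hn d v = u := by
          intro u v h
          rw [Set.mem_compl_singleton_iff, ne_eq, Fin.ext_iff, Fin.ext_iff, diamParent_val]
          change ¬ (v : ℕ) = 0 ∧ _
          split <;> omega
        rcases he.2 with h | h
        · exact ⟨v, (key u v h).1, by simp only [(key u v h).2, Sym2.eq_swap]⟩
        · exact ⟨u, (key v u h).1, by simp only [(key v u h).2]⟩
    have h1 := (Set.ncard_le_ncard hsub (Set.toFinite _)).trans
      (Set.ncard_image_le (Set.toFinite _))
    rw [Set.ncard_compl, Set.ncard_singleton] at h1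
    rw [Nat.card_coe_set_eq]
    simp only [Nat.card_eq_fintype_card, Fintype.card_fin] at h1 ⊢
    omega
  · exact hconn.card_vert_le_card_edgeSet_add_one

lemma le_add_dist_of_adj {V : Type*} {G : SimpleGraph V} (hG : G.Connected) (φ : V → ℕ)
    (hφ : ∀ u v, G.Adj u v → φ u ≤ φ v + 1) (u v : V) : φ u ≤ φ v + G.dist u v := by
  obtain ⟨w, hw⟩ := hG.exists_walk_length_eq_dist u v
  rw [← hw]
  clear hw
  induction w with
  | nil => simp
  | cons h _ ih =>
    have := hφ _ _ h
    rw [Walk.length_cons]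
    omega

lemma diamTree_isGeodesic (hn : d + 1 ≤ n) :
    (diamTree d n).IsGeodesic d (diamPath (Nat.lt_of_lt_of_le d.succ_pos hn)) := by
  have h0 : 0 < n := by omega
  have hconn := diamTree_connected (d := d) h0
  have hupper : ∀ i k, i + k ≤ d →
      (diamTree d n).dist (diamPath h0 i) (diamPath h0 (i + k)) ≤ k := by
    intro i k
    induction k with
    | zero => simp
    | succ k ih =>
      intro hk
      have h1 := ih (by omega)
      have h2 : (diamTree d n).Adj (diamPath h0 (i + k)) (diamPath h0 (i + (k + 1))) := by
        rw [diamTree_adj, ne_eq, Fin.ext_iff, diamPath_val h0 (by omega),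
          diamPath_val h0 (by omega)]
        omega
      have h3 := dist_eq_one_iff_adj.2 h2
      have h4 := hconn.dist_triangle (u := diamPath h0 i) (v := diamPath h0 (i + k))
        (w := diamPath h0 (i + (k + 1)))
      omega
  -- This labelling folds the pendent vertices onto the centre and changes by at most 1 along an
  -- edge, so it bounds distances from below.
  have hlower := le_add_dist_of_adj hconn (fun v => if (v : ℕ) ≤ d then (v : ℕ) else d / 2)
    (by
      intro u v h
      rw [diamTree_adj] at h
      split <;> split <;> omega)
  have key : ∀ i j, i ≤ j → j ≤ d →
      (diamTree d n).dist (diamPath h0 i) (diamPath h0 j) = j - i := by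
    intro i j hij hj
    have h1 := hupper i (j - i) (by omega)
    rw [show i + (j - i) = j by omega] at h1
    have h2 := hlower (diamPath h0 j) (diamPath h0 i)
    simp only [diamPath_val h0 (show i < n by omega), diamPath_val h0 (show j < n by omega),
      hj, hij.trans hj, if_true] at h2
    rw [SimpleGraph.dist_comm] at h2
    omega
  intro i hi j hj
  rcases le_total i j with h | h
  · rw [key i j h hj]
    omega
  · rw [SimpleGraph.dist_comm, key j i h hi]
    omega

lemma diamTree_isSpider (hn : d + 1 ≤ n) :
    IsSpider (diamTree d n) d (diamPath (Nat.lt_of_lt_of_le d.succ_pos hn)) where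
  isGeodesic := diamTree_isGeodesic hn
  adj x hx := by
    have h0 : 0 < n := by omega
    have hxd : d < (x : ℕ) := by
      by_contra! h
      exact mem_offPath.1 hx x h (Fin.ext (diamPath_val h0 x.2))
    rw [diamTree_adj, ne_eq, Fin.ext_iff, diamPath_val h0 (by omega)]
    omega

/-- Pendent vertices are at distance 2 from each other and at most `1 + (d - d / 2)` from the path;
both are at most `d` because `1 < d`. -/
lemma diamTree_diam (hd : 1 < d) (hn : d + 1 ≤ n) : (diamTree d n).diam = d := by
  have h0 : 0 < n := by omega
  have hT := diamTree_isTree (d := d) h0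
  have hp := diamTree_isSpider hn
  have := hT.1.nonempty
  refine le_antisymm ?_ ?_
  · obtain ⟨u, v, huv⟩ := (diamTree d n).exists_dist_eq_diam
    rw [← huv]
    by_cases hu : u ∈ offPath d (diamPath h0) <;> by_cases hv : v ∈ offPath d (diamPath h0)
    · by_cases h : u = v
      · simp [h]
      · rw [hp.dist_off hT hu hv h]
        omega
    · simp only [mem_offPath, not_forall, not_not] at hv
      obtain ⟨i, hi, rfl⟩ := hv
      rw [hp.dist_path hT hu hi]
      omega
    · simp only [mem_offPath, not_forall, not_not] at hu
      obtain ⟨i, hi, rfl⟩ := hu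
      rw [SimpleGraph.dist_comm, hp.dist_path hT hv hi]
      omega
    · simp only [mem_offPath, not_forall, not_not] at hu hv
      obtain ⟨i, hi, rfl⟩ := hu
      obtain ⟨j, hj, rfl⟩ := hv
      rw [hp.isGeodesic i hi j hj]
      omega
  · have h1 := hp.isGeodesic 0 (by omega) d le_rfl
    have h2 := dist_le_diam (connected_iff_ediam_ne_top.1 hT.1) (u := diamPath h0 0)
      (v := diamPath h0 d)
    omega

end DiamTree

/-! ### Extremality for monotone weights -/

section Extremal

variable {d n : ℕ} {V : Type*} [Fintype V] {T : SimpleGraph V}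

/-- The corrections at distance 1 and on the diagonal agree for the two trees and cancel. -/
lemma wienerType_diamTree_le_and_nonempty_iso (hd : 1 < d) (hdn : d + 1 ≤ n) (hT : T.IsTree)
    (hcard : Fintype.card V = n) (hdiam : T.diam = d) {g : ℕ → ℝ} (hg : StrictMono g) :
    wienerType (diamTree d n) g ≤ wienerType T g ∧
      (wienerType T g = wienerType (diamTree d n) g → Nonempty (T ≃g diamTree d n)) := by
  have hS := diamTree_isTree (d := d) (show 0 < n by omega)
  have hq := diamTree_isSpider hdn
  have := hT.1.nonempty
  obtain ⟨u, v, huv⟩ := T.exists_dist_eq_diam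
  obtain ⟨p, hp⟩ := hT.1.exists_isGeodesic u v
  rw [huv, hdiam] at hp
  have hf := strictFromTwo_add_ite hg
  have h1 := extremalPairSum_le hT hp hf
  have h2 := hq.pairSum_eq_extremalPairSum hS fun k => g k + if k = 1 then g 2 - g 1 else 0
  have h3 := exists_isSpider_of_pairSum_eq hT hp (by omega) hf
  rw [hcard, pairSum_add_ite_of_isTree hT, pairSum_eq_two_mul_wienerType_add, hcard] at h1 h3
  rw [Fintype.card_fin, pairSum_add_ite_of_isTree hS, pairSum_eq_two_mul_wienerType_add,
    Fintype.card_fin] at h2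
  refine ⟨by linarith, fun heq => ?_⟩
  obtain ⟨q, hTq⟩ := h3 (by rw [heq, h2])
  exact hTq.nonempty_iso hT hq hS (by rw [hcard, Fintype.card_fin])

/-- For `g` strictly increasing on `1, …, d`, the tree `diamTree d n` is the unique tree of order
`n` and diameter `d` minimising `wienerType`. -/
theorem wienerType_diamTree_le_and_eq_iff (hd : 1 < d) (hdn : d + 1 ≤ n) (hT : T.IsTree)
    (hcard : Fintype.card V = n) (hdiam : T.diam = d) {g : ℕ → ℝ}
    (hg : StrictMonoOn g (Set.Icc 1 d)) :
    wienerType (diamTree d n) g ≤ wienerType T g ∧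
      (wienerType T g = wienerType (diamTree d n) g ↔ Nonempty (T ≃g diamTree d n)) := by
  have hS := diamTree_isTree (d := d) (show 0 < n by omega)
  obtain ⟨g', hg', heq⟩ := exists_strictMono_eqOn hd.le hg
  obtain ⟨h1, h2⟩ := wienerType_diamTree_le_and_nonempty_iso hd hdn hT hcard hdiam hg'
  have h3 : wienerType T g = wienerType T g' :=
    wienerType_congr fun u v huv => heq (hdiam ▸ dist_mem_Icc hT.1 huv)
  have h4 : wienerType (diamTree d n) g = wienerType (diamTree d n) g' :=
    wienerType_congr fun u v huv => heq <| by
      have := dist_mem_Icc hS.1 huv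
      rwa [diamTree_diam hd hdn] at this
  rw [h3, h4]
  exact ⟨h1, h2, fun ⟨φ⟩ => wienerType_eq_of_iso hT.1 hS.1 φ g'⟩

/-- For `g` strictly decreasing on `1, …, d`, the tree `diamTree d n` is the unique tree of order
`n` and diameter `d` maximising `wienerType`. -/
theorem le_wienerType_diamTree_and_eq_iff (hd : 1 < d) (hdn : d + 1 ≤ n) (hT : T.IsTree)
    (hcard : Fintype.card V = n) (hdiam : T.diam = d) {g : ℕ → ℝ}
    (hg : StrictAntiOn g (Set.Icc 1 d)) :
    wienerType T g ≤ wienerType (diamTree d n) g ∧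
      (wienerType T g = wienerType (diamTree d n) g ↔ Nonempty (T ≃g diamTree d n)) := by
  have := wienerType_diamTree_le_and_eq_iff hd hdn hT hcard hdiam (g := fun k => -g k) hg.neg
  simpa only [wienerType_neg, neg_le_neg_iff, neg_inj] using this

end Extremal

end WienerIndices

open WienerIndices in
theorem corollary4 (d n : ℕ) (hd : 1 < d) (hdn : d + 1 ≤ n) :
    ((diamTree d n).IsTree ∧ (diamTree d n).diam = d) ∧
    ∀ (V : Type*) [Fintype V] (T : SimpleGraph V),
      T.IsTree → Fintype.card V = n → T.diam = d →
      (∀ lam : ℝ, 0 < lam →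
        generalisedWiener lam (diamTree d n) ≤ generalisedWiener lam T ∧
        (generalisedWiener lam T = generalisedWiener lam (diamTree d n) ↔
          Nonempty (T ≃g diamTree d n))) ∧
      (∀ lam : ℝ, lam < 0 →
        generalisedWiener lam T ≤ generalisedWiener lam (diamTree d n) ∧
        (generalisedWiener lam T = generalisedWiener lam (diamTree d n) ↔
          Nonempty (T ≃g diamTree d n))) ∧
      (hyperWiener (diamTree d n) ≤ hyperWiener T ∧
        (hyperWiener T = hyperWiener (diamTree d n) ↔ Nonempty (T ≃g diamTree d n))) ∧
      (harary T ≤ harary (diamTree d n) ∧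
        (harary T = harary (diamTree d n) ↔ Nonempty (T ≃g diamTree d n))) ∧
      (reciprocalComplementaryWiener (diamTree d n) ≤ reciprocalComplementaryWiener T ∧
        (reciprocalComplementaryWiener T = reciprocalComplementaryWiener (diamTree d n) ↔
          Nonempty (T ≃g diamTree d n))) := by
  refine ⟨⟨diamTree_isTree (by omega), diamTree_diam hd hdn⟩, ?_⟩
  intro V _ T hT hcard hdiam
  refine ⟨fun lam hlam => ?_, fun lam hlam => ?_, ?_, ?_, ?_⟩
  · refine wienerType_diamTree_le_and_eq_iff hd hdn hT hcard hdiam fun a _ b _ hab => ?_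
    exact Real.rpow_lt_rpow (Nat.cast_nonneg a) (Nat.cast_lt.2 hab) hlam
  · refine le_wienerType_diamTree_and_eq_iff hd hdn hT hcard hdiam fun a ha b _ hab => ?_
    exact Real.rpow_lt_rpow_of_neg (Nat.cast_pos.2 ha.1) (Nat.cast_lt.2 hab) hlam
  · refine wienerType_diamTree_le_and_eq_iff hd hdn hT hcard hdiam fun a ha b _ hab => ?_
    simp only [Nat.cast_choose_two]
    push_cast
    have h1 : (1 : ℝ) ≤ a := Nat.one_le_cast.2 ha.1
    have h2 : (a : ℝ) < b := Nat.cast_lt.2 hab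
    nlinarith
  · refine le_wienerType_diamTree_and_eq_iff hd hdn hT hcard hdiam fun a ha b _ hab => ?_
    exact one_div_lt_one_div_of_lt (Nat.cast_pos.2 ha.1) (Nat.cast_lt.2 hab)
  · unfold reciprocalComplementaryWiener
    -- Fixing the diameter makes the weight the same function of distance for both trees.
    rw [hdiam, diamTree_diam hd hdn]
    refine wienerType_diamTree_le_and_eq_iff hd hdn hT hcard hdiam fun a _ b hb hab => ?_
    have h1 : (a : ℝ) < b := Nat.cast_lt.2 hab
    have h2 : (b : ℝ) ≤ d := Nat.cast_le.2 hb.2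
    exact one_div_lt_one_div_of_lt (by linarith) (by linarith)
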